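/- A de Vries algebra is a complete Boolean algebra $A$ with a binary relation $\prec$ such that: $1\prec 1$; $a\prec b$ implies $a\le b$; $a\le b\prec c\le d$ implies $a\prec d$; $a\prec b$ and $a\prec c$ imply $a\prec b\wedge c$; $a\prec b$ implies $\neg b\prec\neg a$; $a\prec b$ implies $a\prec c\prec b$ for some $c$; and $b=\bigvee\{a\mid a\prec b\}$ for all $b$. A de Vries morphism is a map $\rho:A\to B$ of de Vries algebras with $\rho(0)=0$, $\rho(a\wedge b)=\rho(a)\wedge\rho(b)$, $\neg\rho(\neg a)\prec\rho(b)$ whenever $a\prec b$, and $\rho(b)=\bigvee\{\rho(a)\mid a\prec b\}$. A de Vries extension is a one-to-one de Vries morphism $\alpha:A\to B$ such that $B$ is atomic, the relation $\prec$ of $B$ is $\le$, and every element of $B$ is a join of meets of elements of $\alpha[A]$. A filter $F$ of $A$ is round if $F=\{a\mid b\prec a\text{ for some }b\in F\}$, and an ideal $I$ of $A$ is round if $I=\{a\mid a\prec b\text{ for some }b\in I\}$ (filters and ideals are nonempty, and may be improper). Let $Y_A$ be the set of ends (maximal proper round filters) of $A$, with the topology that has the sets $\zeta(a)=\{x\in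 Y_A\mid a\in x\}$, $a\in A$, as a basis. For a de Vries extension $\alpha:A\to B$, let $X_B$ be the set of atoms of $B$, let $\alpha_*:X_B\to Y_A$ be given by $\alpha_*(b)=\{a\in A\mid c\prec a\text{ for some }c\in A\text{ with }b\le\alpha(c)\}$, and give $X_B$ the least topology that makes $\alpha_*$ continuous. Let $I_\alpha$ be the set of those $a\in A$ such that, for every $S\subseteq A$ with $\neg\alpha(\neg a)\le\bigvee\alpha[S]$, there is a finite $T\subseteq S$ with $\neg\alpha(\neg a)\le\bigvee\alpha[T]$. **Theorem.** For a de Vries extension $\alpha:A\to B$, the following are equivalent. 1. $\alpha$ is compact, that is, if $F$ is a round filter and $I$ a round ideal of $A$ with $\bigwedge\alpha[F]\le\bigvee\alpha[I]$, then $F\cap I\ne\varnothing$. 2. $X_B$ is compact. 3. $I_\alpha=A$. -/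

import Mathlib

universe u v

/-- A de Vries algebra: a complete Boolean algebra with a proximity relation `prec`. -/
class DeVriesAlgebra (A : Type u) extends CompleteBooleanAlgebra A where
  prec : A → A → Prop
  prec_top : prec ⊤ ⊤
  le_of_prec : ∀ {a b : A}, prec a b → a ≤ b
  prec_of_le_of_prec_of_le : ∀ {a b c d : A}, a ≤ b → prec b c → c ≤ d → prec a d
  prec_inf : ∀ {a b c : A}, prec a b → prec a c → prec a (b ⊓ c)
  prec_compl : ∀ {a b : A}, prec a b → prec bᶜ aᶜ
  prec_interpolate : ∀ {a b : A}, prec a b → ∃ c, prec a c ∧ prec c b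
  eq_sSup_prec : ∀ b : A, b = sSup {a | prec a b}

namespace DeVriesAlgebra

section Basic

variable (A : Type u) [DeVriesAlgebra A]

/-- `A` is extremally disconnected: the proximity is the order. -/
def ExtremallyDisconnected : Prop :=
  ∀ a b : A, prec a b ↔ a ≤ b

variable {A}

/-- The elements that some element of `S` is proximal to. -/
def upPrec (S : Set A) : Set A := {a | ∃ b ∈ S, prec b a}

/-- The elements that are proximal to some element of `S`. -/
def downPrec (S : Set A) : Set A := {a | ∃ b ∈ S, prec a b}

/-- Round filters (a `PFilter` is a nonempty filter of the order, possibly improper). -/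
def IsRoundFilter (F : Order.PFilter A) : Prop := upPrec (F : Set A) = F

/-- Round ideals (an `Ideal` is a nonempty ideal of the order, possibly improper). -/
def IsRoundIdeal (I : Order.Ideal A) : Prop := downPrec (I : Set A) = I

/-- An end is a maximal proper round filter. -/
def IsEnd (F : Order.PFilter A) : Prop :=
  Maximal (fun G : Order.PFilter A => IsRoundFilter G ∧ (G : Set A) ≠ Set.univ) F

variable (A) in
/-- The dual space of `A`: the set of ends. -/
def Ends : Type u := {F : Order.PFilter A // IsEnd F}

/-- The set of ends that contain `a`. -/
def zeta (a : A) : Set (Ends A) := {x | a ∈ x.1}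

/-- The topology on the ends with basis the sets `zeta a`. -/
instance : TopologicalSpace (Ends A) :=
  TopologicalSpace.generateFrom (Set.range (zeta : A → Set (Ends A)))

/-- The sets `zeta a` are indeed a basis and not only a subbasis. -/
theorem isTopologicalBasis_range_zeta :
    TopologicalSpace.IsTopologicalBasis (Set.range (zeta : A → Set (Ends A))) where
  exists_subset_inter := by
    rintro _ ⟨a, rfl⟩ _ ⟨b, rfl⟩ x ⟨ha, hb⟩
    refine ⟨zeta (a ⊓ b), ⟨_, rfl⟩, Order.PFilter.inf_mem ha hb, fun y hy => ⟨?_, ?_⟩⟩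
    · exact Order.PFilter.mem_of_le inf_le_left hy
    · exact Order.PFilter.mem_of_le inf_le_right hy
  sUnion_eq := by
    refine Set.eq_univ_of_forall fun x => ?_
    exact ⟨zeta ⊤, ⟨⊤, rfl⟩, Order.PFilter.top_mem⟩
  eq_generateFrom := rfl

end Basic

end DeVriesAlgebra

open DeVriesAlgebra in
/-- De Vries morphisms. -/
structure DeVriesMorphism (A : Type u) (B : Type v) [DeVriesAlgebra A] [DeVriesAlgebra B] where
  toFun : A → B
  map_bot : toFun ⊥ = ⊥
  map_inf : ∀ a b : A, toFun (a ⊓ b) = toFun a ⊓ toFun b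
  map_prec : ∀ a b : A, prec a b → prec (toFun aᶜ)ᶜ (toFun b)
  map_eq_sSup : ∀ b : A, toFun b = sSup (toFun '' {a | prec a b})

open DeVriesAlgebra in
/-- A de Vries extension: a one-to-one de Vries morphism into an atomic extremally disconnected
de Vries algebra whose image is join-meet dense. -/
structure DeVriesExtension (A : Type u) (B : Type v) [DeVriesAlgebra A] [DeVriesAlgebra B]
    extends DeVriesMorphism A B where
  isAtomic : IsAtomic B
  extremallyDisconnected : ExtremallyDisconnected B
  injective : Function.Injective toFun
  joinMeetDense : ∀ b : B, ∃ 𝒮 : Set (Set A), b = sSup ((fun S => sInf (toFun '' S)) '' 𝒮)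

namespace DeVriesMorphism

open DeVriesAlgebra

variable {A : Type u} {B : Type v} [DeVriesAlgebra A] [DeVriesAlgebra B]

theorem monotone (ρ : DeVriesMorphism A B) : Monotone ρ.toFun := by
  intro a b h
  have := ρ.map_inf a b
  rw [inf_eq_left.2 h] at this
  rw [this]
  exact inf_le_right

theorem map_top (ρ : DeVriesMorphism A B) : ρ.toFun ⊤ = ⊤ := by
  have h := le_of_prec (ρ.map_prec ⊤ ⊤ prec_top)
  rw [compl_top, ρ.map_bot, compl_bot] at h
  exact top_le_iff.1 h

/-- For an element `b` of `B`, the filter of all elements that some `a` with `b ≤ ρ a` is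
proximal to. -/
def pullback (ρ : DeVriesMorphism A B) (b : B) : Order.PFilter A :=
  Order.IsPFilter.toPFilter (F := upPrec (ρ.toFun ⁻¹' Set.Ici b)) <| by
    refine Order.IsPFilter.of_def ?_ ?_ ?_
    · exact ⟨⊤, ⊤, by simp [ρ.map_top], prec_top⟩
    · rintro x ⟨c, hc, hcx⟩ y ⟨d, hd, hdy⟩
      refine ⟨x ⊓ y, ⟨c ⊓ d, ?_, ?_⟩, inf_le_left, inf_le_right⟩
      · rw [Set.mem_preimage, Set.mem_Ici, ρ.map_inf]
        exact le_inf hc hd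
      · exact prec_inf (prec_of_le_of_prec_of_le inf_le_left hcx le_rfl)
          (prec_of_le_of_prec_of_le inf_le_right hdy le_rfl)
    · rintro x y hxy ⟨c, hc, hcx⟩
      exact ⟨c, hc, prec_of_le_of_prec_of_le le_rfl hcx hxy⟩

theorem mem_pullback (ρ : DeVriesMorphism A B) (b : B) (a : A) :
    a ∈ ρ.pullback b ↔ ∃ c, b ≤ ρ.toFun c ∧ prec c a := Iff.rfl

theorem isEnd_pullback (ρ : DeVriesMorphism A B) {b : B} (hb : IsAtom b) :
    IsEnd (ρ.pullback b) := by
  refine ⟨⟨?_, ?_⟩, ?_⟩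
  · ext a
    constructor
    · rintro ⟨c, hc, hca⟩
      exact Order.PFilter.mem_of_le (le_of_prec hca) hc
    · rintro ⟨c, hc, hca⟩
      obtain ⟨d, hcd, hda⟩ := prec_interpolate hca
      exact ⟨d, ⟨c, hc, hcd⟩, hda⟩
  · intro h
    have h0 : (⊥ : A) ∈ (ρ.pullback b : Set A) := by rw [h]; trivial
    obtain ⟨c, hc, hc0⟩ := h0
    rw [le_bot_iff.1 (le_of_prec hc0)] at hc
    have hc' : b ≤ ρ.toFun ⊥ := hc
    rw [ρ.map_bot] at hc'
    exact hb.1 (le_bot_iff.1 hc')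
  · rintro G ⟨hG, hG'⟩ hle g hg
    have down : ∀ x ∈ G, ∃ y ∈ G, prec y x := by
      intro x hx
      have hx' : x ∈ upPrec (G : Set A) := by
        rw [show upPrec (G : Set A) = G from hG]; exact hx
      exact hx'
    obtain ⟨g₁, hg₁, h₁⟩ := down g hg
    obtain ⟨g₂, hg₂, h₂⟩ := down g₁ hg₁
    obtain ⟨g₃, hg₃, h₃⟩ := down g₂ hg₂
    by_cases hbg : b ≤ ρ.toFun g₁
    · exact ⟨g₁, hbg, h₁⟩
    · exfalso
      have hdisj : b ≤ (ρ.toFun g₁)ᶜ := by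
        rw [le_compl_iff_disjoint_right]
        exact hb.not_le_iff_disjoint.1 hbg
      have hle' : b ≤ ρ.toFun g₂ᶜ :=
        hdisj.trans (compl_le_of_compl_le (le_of_prec (ρ.map_prec _ _ h₂)))
      have hmem : g₃ᶜ ∈ G := hle ((ρ.mem_pullback b _).2 ⟨g₂ᶜ, hle', prec_compl h₃⟩)
      have hbot : (⊥ : A) ∈ G := by
        have := Order.PFilter.inf_mem hg₃ hmem
        rwa [inf_compl_self] at this
      exact hG' (Set.eq_univ_of_forall fun x => Order.PFilter.mem_of_le bot_le hbot)

end DeVriesMorphism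

namespace DeVriesExtension

open DeVriesAlgebra

variable {A : Type u} {B : Type v} [DeVriesAlgebra A] [DeVriesAlgebra B]

/-- The set of atoms of `B`, the underlying set of the space attached to the extension `α`. -/
def AtomSpace (_α : DeVriesExtension A B) : Type v := {b : B // IsAtom b}

/-- The map from the atoms of `B` to the ends of `A`. -/
def lowerStar (α : DeVriesExtension A B) (b : α.AtomSpace) : Ends A :=
  ⟨α.toDeVriesMorphism.pullback b.1, α.toDeVriesMorphism.isEnd_pullback b.2⟩

/-- The least topology on the atoms of `B` that makes `α.lowerStar` continuous. -/
instance (α : DeVriesExtension A B) : TopologicalSpace α.AtomSpace :=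
  TopologicalSpace.induced α.lowerStar inferInstance

/-- Compact de Vries extensions. -/
def IsCompactExtension (α : DeVriesExtension A B) : Prop :=
  ∀ (F : Order.PFilter A) (I : Order.Ideal A), IsRoundFilter F → IsRoundIdeal I →
    sInf (α.toFun '' (F : Set A)) ≤ sSup (α.toFun '' (I : Set A)) →
    ((F : Set A) ∩ (I : Set A)).Nonempty

/-- `a` is `α`-compact. -/
def IsCompactElem (α : DeVriesExtension A B) (a : A) : Prop :=
  ∀ S : Set A, (α.toFun aᶜ)ᶜ ≤ sSup (α.toFun '' S) →
    ∃ T : Set A, T ⊆ S ∧ T.Finite ∧ (α.toFun aᶜ)ᶜ ≤ sSup (α.toFun '' T)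

/-- The set of `α`-compact elements of `A`. -/
def compactElems (α : DeVriesExtension A B) : Set A := {a | α.IsCompactElem a}

end DeVriesExtension

namespace DeVriesAlgebra

variable {A : Type u} [DeVriesAlgebra A]

/-! All three conditions are equivalent to `α.IsCompactElem ⊤`: whenever `α[S]` joins to `⊤`, so
does `α[T]` for some finite `T ⊆ S`. For an atom `b`, `a` lies in `α_*(b)` exactly when `b ≤ α a`,
so the sets `atomsBelow a` generate the topology; as `B` is atomic, they cover the space exactly
when the corresponding `α a` join to `⊤`. Compactness of `⊤` passes to every `a` by adjoining `aᶜ`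
to the cover. For compact extensions, a cover `S` is tested against the filter `{⊤}` and the ideal
`finiteCoverIdeal S`; conversely, a pair `F`, `I` yields the cover `I ∪ ¬F`. -/

theorem prec_bot : prec (⊥ : A) ⊥ := by
  simpa using prec_compl (prec_top (A := A))

theorem prec_sup {a b c d : A} (h₁ : prec a b) (h₂ : prec c d) : prec (a ⊔ c) (b ⊔ d) := by
  have h := prec_compl (prec_inf
    (prec_of_le_of_prec_of_le inf_le_left (prec_compl h₁) le_rfl)
    (prec_of_le_of_prec_of_le inf_le_right (prec_compl h₂) le_rfl))
  simpa [compl_inf] using h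

theorem isRoundFilter_principal_top : IsRoundFilter (Order.PFilter.principal (⊤ : A)) := by
  ext a
  constructor
  · rintro ⟨b, hb, hba⟩
    exact Order.PFilter.mem_of_le (le_of_prec hba) hb
  · intro ha
    refine ⟨⊤, Order.PFilter.top_mem, ?_⟩
    rw [top_le_iff.1 (Order.PFilter.mem_principal.1 ha)]
    exact prec_top

end DeVriesAlgebra

namespace DeVriesMorphism

open DeVriesAlgebra

variable {A : Type u} {B : Type v} [DeVriesAlgebra A] [DeVriesAlgebra B]

theorem map_le_compl_map_compl (ρ : DeVriesMorphism A B) (a : A) :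
    ρ.toFun a ≤ (ρ.toFun aᶜ)ᶜ := by
  rw [le_compl_iff_disjoint_right, disjoint_iff, ← ρ.map_inf, inf_compl_self, ρ.map_bot]

theorem compl_map_compl_le (ρ : DeVriesMorphism A B) {a b : A} (h : prec a b) :
    (ρ.toFun aᶜ)ᶜ ≤ ρ.toFun b :=
  le_of_prec (ρ.map_prec a b h)

theorem compl_map_compl_top (ρ : DeVriesMorphism A B) : (ρ.toFun (⊤ : A)ᶜ)ᶜ = ⊤ := by
  rw [compl_top, ρ.map_bot, compl_bot]

theorem compl_map_compl_sup (ρ : DeVriesMorphism A B) (a b : A) :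
    (ρ.toFun (a ⊔ b)ᶜ)ᶜ = (ρ.toFun aᶜ)ᶜ ⊔ (ρ.toFun bᶜ)ᶜ := by
  rw [compl_sup, ρ.map_inf, compl_inf]

theorem le_of_map_le (ρ : DeVriesMorphism A B) (hρ : Function.Injective ρ.toFun) {a b : A}
    (h : ρ.toFun a ≤ ρ.toFun b) : a ≤ b := by
  rw [← inf_eq_left]
  apply hρ
  rw [ρ.map_inf, inf_eq_left.2 h]

end DeVriesMorphism

theorem IsAtom.exists_le_of_le_sSup {B : Type v} [CompleteBooleanAlgebra B] {b : B}
    (hb : IsAtom b) {S : Set B} (h : b ≤ sSup S) : ∃ s ∈ S, b ≤ s := by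
  by_contra! hS
  refine hb.1 (disjoint_self.1 (Disjoint.mono_right h ?_))
  rw [disjoint_sSup_iff]
  exact fun s hs => hb.not_le_iff_disjoint.1 (hS s hs)

theorem top_le_of_forall_isAtom_le {B : Type v} [BooleanAlgebra B] [IsAtomic B] {x : B}
    (h : ∀ b, IsAtom b → b ≤ x) : ⊤ ≤ x := by
  rcases eq_bot_or_exists_atom_le xᶜ with hx | ⟨b, hb, hbx⟩
  · exact (compl_eq_bot.1 hx).ge
  · exact absurd (disjoint_self.1 (Disjoint.mono (h b hb) hbx disjoint_compl_right)) hb.1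

namespace DeVriesExtension

open DeVriesAlgebra

variable {A : Type u} {B : Type v} [DeVriesAlgebra A] [DeVriesAlgebra B]

/-! ### Compactness of the space of atoms -/

theorem mem_lowerStar_iff (α : DeVriesExtension A B) (b : α.AtomSpace) (a : A) :
    a ∈ (α.lowerStar b).1 ↔ b.1 ≤ α.toFun a := by
  refine (α.toDeVriesMorphism.mem_pullback b.1 a).trans ⟨?_, fun h => ?_⟩
  · rintro ⟨c, hc, hca⟩
    exact hc.trans (α.toDeVriesMorphism.monotone (le_of_prec hca))
  -- An atom below a join lies below one of its members, which supplies some `c ≺ a`.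
  · rw [α.map_eq_sSup] at h
    obtain ⟨_, ⟨c, hc, rfl⟩, hbc⟩ := b.2.exists_le_of_le_sSup h
    exact ⟨c, hbc, hc⟩

/-- The atoms below `α a`. -/
def atomsBelow (α : DeVriesExtension A B) (a : A) : Set α.AtomSpace := {b | b.1 ≤ α.toFun a}

theorem preimage_zeta (α : DeVriesExtension A B) (a : A) :
    α.lowerStar ⁻¹' zeta a = α.atomsBelow a :=
  Set.ext fun b => α.mem_lowerStar_iff b a

theorem topology_eq_generateFrom (α : DeVriesExtension A B) :
    (inferInstance : TopologicalSpace α.AtomSpace) =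
      TopologicalSpace.generateFrom (Set.range α.atomsBelow) := by
  refine (induced_generateFrom_eq (f := α.lowerStar)).trans ?_
  rw [← Set.range_comp]
  exact congrArg _ (congrArg _ (funext α.preimage_zeta))

theorem isOpen_atomsBelow (α : DeVriesExtension A B) (a : A) : IsOpen (α.atomsBelow a) := by
  rw [← α.preimage_zeta]
  exact isOpen_induced (isTopologicalBasis_range_zeta.isOpen ⟨a, rfl⟩)

theorem top_le_sSup_iff (α : DeVriesExtension A B) (S : Set A) :
    ⊤ ≤ sSup (α.toFun '' S) ↔ ⋃ s ∈ S, α.atomsBelow s = Set.univ := by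
  have := α.isAtomic
  simp only [Set.eq_univ_iff_forall, Set.mem_iUnion₂]
  constructor
  · intro h b
    obtain ⟨_, ⟨s, hs, rfl⟩, hbs⟩ := b.2.exists_le_of_le_sSup (le_top.trans h)
    exact ⟨s, hs, hbs⟩
  · refine fun h => top_le_of_forall_isAtom_le fun b hb => ?_
    obtain ⟨s, hs, hbs⟩ := h ⟨b, hb⟩
    exact le_trans hbs (le_sSup ⟨s, hs, rfl⟩)

theorem isCompactElem_top_iff (α : DeVriesExtension A B) :
    α.IsCompactElem ⊤ ↔ ∀ S : Set A, ⊤ ≤ sSup (α.toFun '' S) →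
      ∃ T : Set A, T ⊆ S ∧ T.Finite ∧ ⊤ ≤ sSup (α.toFun '' T) := by
  rw [IsCompactElem, α.toDeVriesMorphism.compl_map_compl_top]

theorem compactSpace_iff_isCompactElem_top (α : DeVriesExtension A B) :
    CompactSpace α.AtomSpace ↔ α.IsCompactElem ⊤ := by
  simp only [isCompactElem_top_iff, top_le_sSup_iff]
  constructor
  · intro _ S hS
    obtain ⟨T, hTS, hT, hcover⟩ := isCompact_univ.elim_finite_subcover_image
      (fun s _ => α.isOpen_atomsBelow s) hS.ge
    exact ⟨T, hTS, hT, Set.univ_subset_iff.1 hcover⟩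
  · intro h
    -- Alexander's subbase theorem: covers by sets `atomsBelow s` suffice.
    refine compactSpace_generateFrom α.topology_eq_generateFrom fun P hP hcover => ?_
    obtain ⟨T, hTP, hT, hTcover⟩ := h (α.atomsBelow ⁻¹' P) <| by
      rw [← Set.sUnion_image, Set.image_preimage_eq_of_subset hP, hcover]
    refine ⟨α.atomsBelow '' T, Set.image_subset_iff.2 hTP, hT.image _, ?_⟩
    rw [Set.sUnion_image, hTcover]

/-! ### Compactness of the elements of `A` -/

theorem IsCompactElem.of_top {α : DeVriesExtension A B} (h : α.IsCompactElem ⊤) (a : A) :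
    α.IsCompactElem a := by
  intro S hS
  obtain ⟨T, hTS, hT, hcover⟩ := α.isCompactElem_top_iff.1 h (insert aᶜ S) <| by
    rw [Set.image_insert_eq, sSup_insert, ← sdiff_le_iff, top_sdiff]
    exact hS
  -- Whether or not `T` uses `aᶜ`, the rest of `T` must cover the complement of `α aᶜ`.
  refine ⟨T \ {aᶜ}, Set.sdiff_singleton_subset_iff.2 hTS, hT.sdiff, ?_⟩
  rw [← top_sdiff, sdiff_le_iff, ← sSup_insert, ← Set.image_insert_eq, Set.insert_sdiff_singleton]
  exact hcover.trans (sSup_le_sSup (Set.image_mono (Set.subset_insert _ _)))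

theorem compactElems_eq_univ_iff (α : DeVriesExtension A B) :
    α.compactElems = Set.univ ↔ α.IsCompactElem ⊤ :=
  ⟨fun h => Set.eq_univ_iff_forall.1 h ⊤, fun h => Set.eq_univ_of_forall h.of_top⟩

/-! ### Compact extensions -/

/-- The round ideal of all elements proximal to some `d` for which `¬α(¬d)` is covered by finitely
many members of `α[S]`. -/
def finiteCoverIdeal (α : DeVriesExtension A B) (S : Set A) : Order.Ideal A :=
  Order.IsIdeal.toIdeal (I := {a | ∃ T : Set A, T ⊆ S ∧ T.Finite ∧
      ∃ d, prec a d ∧ (α.toFun dᶜ)ᶜ ≤ sSup (α.toFun '' T)})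
    { IsLowerSet := by
        rintro a b hba ⟨T, hTS, hT, d, had, hd⟩
        exact ⟨T, hTS, hT, d, prec_of_le_of_prec_of_le hba had le_rfl, hd⟩
      Nonempty := by
        refine ⟨⊥, ∅, Set.empty_subset S, Set.finite_empty, ⊥, prec_bot, ?_⟩
        rw [compl_bot, α.toDeVriesMorphism.map_top, compl_top]
        exact bot_le
      Directed := by
        rintro a ⟨T, hTS, hT, d, had, hd⟩ b ⟨U, hUS, hU, e, hbe, he⟩
        refine ⟨a ⊔ b, ⟨T ∪ U, Set.union_subset hTS hUS, hT.union hU, d ⊔ e,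
          prec_sup had hbe, ?_⟩, le_sup_left, le_sup_right⟩
        -- `α` need not preserve joins, but `a ↦ (α aᶜ)ᶜ` preserves binary ones; hence its use in
        -- the ideal.
        rw [α.toDeVriesMorphism.compl_map_compl_sup, Set.image_union, sSup_union]
        exact sup_le_sup hd he }

theorem mem_finiteCoverIdeal (α : DeVriesExtension A B) (S : Set A) (a : A) :
    a ∈ α.finiteCoverIdeal S ↔ ∃ T : Set A, T ⊆ S ∧ T.Finite ∧
      ∃ d, prec a d ∧ (α.toFun dᶜ)ᶜ ≤ sSup (α.toFun '' T) := Iff.rfl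

theorem isRoundIdeal_finiteCoverIdeal (α : DeVriesExtension A B) (S : Set A) :
    IsRoundIdeal (α.finiteCoverIdeal S) := by
  ext a
  constructor
  · rintro ⟨b, hb, hab⟩
    exact (α.finiteCoverIdeal S).lower (le_of_prec hab) hb
  · rintro ⟨T, hTS, hT, d, had, hd⟩
    obtain ⟨e, hae, hed⟩ := prec_interpolate had
    exact ⟨e, ⟨T, hTS, hT, d, hed, hd⟩, hae⟩

theorem sSup_le_sSup_finiteCoverIdeal (α : DeVriesExtension A B) (S : Set A) :
    sSup (α.toFun '' S) ≤ sSup (α.toFun '' (α.finiteCoverIdeal S : Set A)) := by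
  refine sSup_le ?_
  rintro _ ⟨s, hs, rfl⟩
  rw [α.map_eq_sSup s]
  refine sSup_le_sSup (Set.image_mono fun c hc => ?_)
  obtain ⟨d, hcd, hds⟩ := prec_interpolate (show prec c s from hc)
  refine ⟨{s}, Set.singleton_subset_iff.2 hs, Set.finite_singleton s, d, hcd, ?_⟩
  rw [Set.image_singleton, sSup_singleton]
  exact α.toDeVriesMorphism.compl_map_compl_le hds

theorem IsCompactExtension.isCompactElem_top {α : DeVriesExtension A B}
    (h : α.IsCompactExtension) : α.IsCompactElem ⊤ := by
  refine α.isCompactElem_top_iff.2 fun S hS => ?_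
  obtain ⟨a, ha, haS⟩ := h _ (α.finiteCoverIdeal S) isRoundFilter_principal_top
    (α.isRoundIdeal_finiteCoverIdeal S)
    (le_top.trans (hS.trans (α.sSup_le_sSup_finiteCoverIdeal S)))
  obtain ⟨T, hTS, hT, d, had, hd⟩ := (α.mem_finiteCoverIdeal S a).1 haS
  obtain rfl : d = ⊤ :=
    top_le_iff.1 ((Order.PFilter.mem_principal.1 ha).trans (le_of_prec had))
  exact ⟨T, hTS, hT, by rwa [α.toDeVriesMorphism.compl_map_compl_top] at hd⟩

/-- Members taken from `I` are absorbed into their join `a`, and complements `gᶜ` into `fᶜ` for `f`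
the meet of the `g`; monotonicity of `α` suffices. -/
theorem exists_sSup_le_of_finite (α : DeVriesExtension A B) (F : Order.PFilter A)
    (I : Order.Ideal A) {T : Set A} (hT : T.Finite)
    (hTS : T ⊆ (I : Set A) ∪ compl '' (F : Set A)) :
    ∃ a ∈ I, ∃ f ∈ F, sSup (α.toFun '' T) ≤ α.toFun a ⊔ α.toFun fᶜ := by
  have mono := α.toDeVriesMorphism.monotone
  induction T, hT using Set.Finite.induction_on with
  | empty => exact ⟨⊥, I.bot_mem, ⊤, Order.PFilter.top_mem, by simp⟩
  | @insert t T _ _ ih =>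
    obtain ⟨ht, hTS⟩ := Set.insert_subset_iff.1 hTS
    obtain ⟨a, ha, f, hf, h⟩ := ih hTS
    rw [Set.image_insert_eq, sSup_insert]
    rcases ht with ht | ⟨g, hg, rfl⟩
    · refine ⟨t ⊔ a, Order.Ideal.sup_mem ht ha, f, hf, sup_le ?_ (h.trans ?_)⟩
      · exact le_sup_of_le_left (mono le_sup_left)
      · exact sup_le_sup_right (mono le_sup_right) _
    · refine ⟨a, ha, g ⊓ f, Order.PFilter.inf_mem hg hf, sup_le ?_ (h.trans ?_)⟩
      · exact le_sup_of_le_right (mono (compl_le_compl inf_le_left))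
      · exact sup_le_sup_left (mono (compl_le_compl inf_le_right)) _

theorem IsCompactElem.isCompactExtension {α : DeVriesExtension A B} (h : α.IsCompactElem ⊤) :
    α.IsCompactExtension := by
  intro F I hF _ hFI
  -- Roundness of `F` gives `g ≺ f` with `g ∈ F`, whence `(α gᶜ)ᶜ ≤ α f`.
  have hcompl : (sSup (α.toFun '' (compl '' (F : Set A))))ᶜ ≤ sInf (α.toFun '' (F : Set A)) := by
    refine le_sInf ?_
    rintro _ ⟨f, hf, rfl⟩
    rw [← hF] at hf
    obtain ⟨g, hg, hgf⟩ := hf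
    exact (compl_le_compl (le_sSup (Set.mem_image_of_mem _ (Set.mem_image_of_mem _ hg)))).trans
      (α.toDeVriesMorphism.compl_map_compl_le hgf)
  obtain ⟨T, hTS, hT, hcover⟩ := α.isCompactElem_top_iff.1 h
    ((I : Set A) ∪ compl '' (F : Set A)) <| by
      rw [Set.image_union, sSup_union, ← sdiff_le_iff', top_sdiff]
      exact hcompl.trans hFI
  obtain ⟨a, ha, f, hf, hle⟩ := α.exists_sSup_le_of_finite F I hT hTS
  -- `α a ⊔ α fᶜ = ⊤`, so `α f ≤ (α fᶜ)ᶜ ≤ α a`, and injectivity reflects the order.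
  have hfa : (α.toFun fᶜ)ᶜ ≤ α.toFun a := by
    rw [← top_sdiff, sdiff_le_iff']
    exact hcover.trans hle
  have : f ≤ a := α.toDeVriesMorphism.le_of_map_le α.injective
    ((α.toDeVriesMorphism.map_le_compl_map_compl f).trans hfa)
  exact ⟨a, Order.PFilter.mem_of_le this hf, ha⟩

end DeVriesExtension

theorem mainTheorem6 {A : Type u} {B : Type v} [DeVriesAlgebra A] [DeVriesAlgebra B]
    (α : DeVriesExtension A B) :
    List.TFAE [α.IsCompactExtension, CompactSpace α.AtomSpace, α.compactElems = Set.univ] := by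
  rw [α.compactSpace_iff_isCompactElem_top, α.compactElems_eq_univ_iff]
  tfae_have 1 → 2 := fun h => h.isCompactElem_top
  tfae_have 2 → 1 := fun h => h.isCompactExtension
  tfae_have 2 ↔ 3 := Iff.rfl
  tfae_finish
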